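/- \textbf{Model.} An order book state is a triple $u=(q^1,q^2,s)$ with $q^1,q^2\in\mathbb N$ not both $0$ (best bid and ask quantities) and spread $s\in\alpha_0\mathbb N$, where $\alpha_0>0$ is the tick; $\mathbb U$ is the set of states. An event is $e=(n,t,\sigma,b,\tilde u,u,a)$ with size $n\in\mathbb N^*$, price level $t\in\mathbb N$, direction $\sigma\in\{+1,-1\}$, type $b\in\{1,2\}$, state $\tilde u\in\mathbb U$ used after a depletion, state $u\in\mathbb U$ of the book after the event, and agent $a\in\{1,\dots,N\}$; $E$ is the countable set of events. The event $e$ is a possible update of the state $v=(q^1,q^2,s)$ if, with $\epsilon=1$ when $\sigma=-1$ and $n\ge q^b$, and $\epsilon=0$ otherwise, its after-state is $u=(1-\epsilon)v+\epsilon\tilde u+(m^1,m^2,-(t^1+t^2))$, where $$t^1=\min(t\alpha_0,s-\alpha_0)\mathbf 1_{\{b=1,\,t\neq0\}},\qquad t^2=(s-t\alpha_0)_+\mathbf 1_{\{b=2,\,t\neq s/\alpha_0\}},$$ $$m^i=n\big(\mathbf 1_{\{\sigma=1,\,t=\ell_i,\,b=i\}}-\mathbf 1_{\{\sigma=-1,\,t=\ell_i,\,b=i,\,n<q^i\}}+\mathbf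 1_{\{\sigma=1,\,t\notin\{0,s/\alpha_0\},\,b=i\}}\big),\qquad \ell_1=0,\ \ell_2=s/\alpha_0 .$$ A past is a sequence of events at times $\cdots<T_{-1}<T_0<0$. Let $\mu$ be a probability measure on the space of pasts, and let $\mathbb P_\mu$ be the law of a marked point process $(T_i,X_i)_{i\in\mathbb Z}$ whose past has law $\mu$, whose later events $0<T_1<T_2<\cdots\le\infty$ (strictly increasing while finite) satisfy $T_n\to\infty$ a.s., in which every event is a possible update of the state $U_{i-1}$ left by the previous event (so that $X_i$ has after-state $U_i$), and whose intensity, for the filtration generated by the past and by the events up to time $t$, is $$\lambda_t(e)=\psi\Big(e,U_{t^-},t,\sum_{T_i<t}\phi(e,U_{t^-},t-T_i,X_i)\Big)$$ with measurable $\psi,\phi\ge0$. That is, $\mathbb E_\mu\big[\sum_{n\ge1,\,T_n<\infty,\,X_n=e}C_{T_n}\big]=\mathbb E_\mu\big[\int_0^\infty C_s\lambda_s(e)\,ds\big]$ for every event $e$ and every nonnegative predictable process $C$. Assume that $\mu$ is invariant: the joint law under $\mathbb P_\mu$ of the order book path $(U_i)_{T_i\le t}$, numbered backwards from the last event before or at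 $t$, and of $(\lambda_t(e))_{e\in E}$ does not depend on $t\ge0$. Let $Z$ be a countable space whose singletons are measurable, let $f$ be a measurable $Z$-valued function of the path, and let $\zeta_t=f((U_i)_{T_i\le t})$. For $z\ne z'$, let $E(z,z')$ be the set of events that lead $\zeta$ directly from $z$ to $z'$: when $\zeta_0=z$, an event $e$ belongs to it if $e$ is a possible update of $U_0$ and $f$ takes the value $z'$ on the path extended by the after-state of $e$. In general this set may depend on the path at time $0$. Put, in $[0,\infty]$, $$Q(z,z')=\sum_{e\in E}\mathbb E_\mu\big[\lambda_0(e)\mathbf 1_{\{e\in E(z,z')\}}\,\big|\,\zeta_0=z\big]\quad(z\ne z'),\qquad Q(z,z)=-\sum_{z'\ne z}Q(z,z'),$$ with the convention that conditional expectations given an event of probability $0$ are $0$. \textbf{Proposition.} Let $\pi(z)=\mathbb P_\mu[\zeta_0=z]$. \begin{enumerate} \item $\mathbb P_\mu[\zeta_t=z]=\pi(z)$ for all $t\ge0$ and $z\in Z$, and $\pi\mathbf 1=\sum_z\pi(z)=1$. \item $\pi Q=0$. For every $z\in Z$, without any integrability assumption, $\sum_{z'\ne z}\pi(z')Q(z',z)=\pi(z)\sum_{z'\ne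 z}Q(z,z')$ in $[0,\infty]$ (with $0\cdot\infty=0$). For every $z$ such that $Q(z,z)$ is finite, $\sum_{z'}\pi(z')Q(z',z)=0$ as an absolutely convergent series. If $\sum_{e}\mathbb E_\mu[\lambda_0(e)]<\infty$, then all $Q(z,z)$ are finite, so that the last equation holds for every $z$. \item If $z\neq z'$ and $E(z,z')$ is a fixed set of events (up to events with $\lambda_0(e)=0$, almost surely on $\{\zeta_0=z\}$), then $Q(z,z')=\sum_{e\in E(z,z')}\mathbb E_\mu[\lambda_0(e)\mid\zeta_0=z]$. \end{enumerate} -/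

import Mathlib

open MeasureTheory ProbabilityTheory Filter Topology
open scoped NNReal ENNReal

noncomputable section

namespace OrderBook

/-- The two sides of the book: type `1` is the bid, type `2` is the ask. -/
inductive Side
  | bid
  | ask

/-- An order book state `(Q¹, Q², S)`: the best bid quantity, the best ask quantity and the spread.
The spread is counted in ticks (`S = α₀ * spread`); the two quantities do not both vanish. -/
structure State where
  bid : ℕ
  ask : ℕ
  spread : ℕ
  reachable : ¬ (bid = 0 ∧ ask = 0)

/-- An order book event: size, price level in ticks above the best bid, direction (`+1` provides
liquidity, `-1` removes it), side, state used after a depletion, state of the book after the event,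
and identity of the agent. -/
structure Event (N : ℕ) where
  size : ℕ+
  price : ℕ
  dir : ℤˣ
  side : Side
  depleted : State
  after : State
  agent : Fin N

instance : MeasurableSpace State := ⊤

instance (N : ℕ) : MeasurableSpace (Event N) := ⊤

variable {N : ℕ}

/-- The quantity available at the best limit of a side. -/
def State.qty (u : State) : Side → ℕ
  | .bid => u.bid
  | .ask => u.ask

/-- The price level, in ticks above the best bid, of the best limit of a side. -/
def State.level (u : State) : Side → ℕ
  | .bid => 0
  | .ask => u.spread

/-- The event `e` depletes a best limit of the book in state `u`. -/
def Depletes (u : State) (e : Event N) : Prop :=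
  e.dir = -1 ∧ u.qty e.side ≤ (e.size : ℕ)

open scoped Classical in
/-- Spread variation `t¹` caused by a buy order inside the spread. -/
def spreadCutBid (u : State) (e : Event N) : ℤ :=
  if e.side = Side.bid ∧ e.price ≠ 0 then min (e.price : ℤ) ((u.spread : ℤ) - 1) else 0

open scoped Classical in
/-- Spread variation `t²` caused by a sell order inside the spread. -/
def spreadCutAsk (u : State) (e : Event N) : ℤ :=
  if e.side = Side.ask ∧ e.price ≠ u.spread then max ((u.spread : ℤ) - (e.price : ℤ)) 0 else 0

open scoped Classical in
/-- The increment `n^{i,+} - n^{i,-} + n^{i,1/2}` of the best quantity on side `i`: insertion at the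
best limit, consumption at the best limit without depletion, insertion inside the spread. -/
def qtyIncrement (u : State) (e : Event N) (i : Side) : ℤ :=
  (if e.dir = 1 ∧ e.price = u.level i ∧ e.side = i then (e.size : ℤ) else 0)
    - (if e.dir = -1 ∧ e.price = u.level i ∧ e.side = i ∧ (e.size : ℕ) < u.qty i
        then (e.size : ℤ) else 0)
    + (if e.dir = 1 ∧ e.price ≠ 0 ∧ e.price ≠ u.spread ∧ e.side = i then (e.size : ℤ) else 0)

open scoped Classical in
/-- The order book dynamics: the event `e`, occurring when the book is in state `u`, leaves the book
in the state `e.after`. -/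
def IsUpdate (u : State) (e : Event N) : Prop :=
  (e.after.spread : ℤ) = (if Depletes u e then (e.depleted.spread : ℤ) else (u.spread : ℤ))
      - (spreadCutBid u e + spreadCutAsk u e) ∧
  ∀ i : Side, (e.after.qty i : ℤ) =
    (if Depletes u e then (e.depleted.qty i : ℤ) else (u.qty i : ℤ)) + qtyIncrement u e i

/-- A past of the market seen from time `0`: the entry `k` is the `k`-th most recent event (`k = 0`
being the last one) together with its age, so that it occurred at time `-age`. -/
abbrev History (N : ℕ) : Type := ℕ → ℝ≥0 × Event N

/-- A past together with the events `(T₁, X₁), (T₂, X₂), …` after time `0` (indexed here from `0`);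
`T n = ∞` means that there are at most `n` events after time `0`. -/
abbrev Config (N : ℕ) : Type := History N × (ℕ → ℝ≥0∞ × Event N)

/-- The age at time `0` of the `k`-th most recent past event. -/
def age (k : ℕ) (ω : Config N) : ℝ≥0 := (ω.1 k).1

/-- The `k`-th most recent past event at time `0`. -/
def pastEvent (k : ℕ) (ω : Config N) : Event N := (ω.1 k).2

/-- The time of the event number `n` after time `0`. -/
def T (n : ℕ) (ω : Config N) : ℝ≥0∞ := (ω.2 n).1

/-- The event number `n` after time `0`. -/
def X (n : ℕ) (ω : Config N) : Event N := (ω.2 n).2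

/-- Past order book states: the entry `k` is the state after the `k`-th most recent event. -/
abbrev Path : Type := ℕ → State

/-- The path obtained when a new event leaves the book in the state `u`. -/
def Path.push (p : Path) (u : State) : Path
  | 0 => u
  | k + 1 => p k

/-- The past order book states just after the first `m` events that follow time `0`. -/
def pathAfter (ω : Config N) : ℕ → Path
  | 0 => fun k => (pastEvent k ω).after
  | m + 1 => Path.push (pathAfter ω m) (X m ω).after

/-- The order book path `(U_i)_{T_i ≤ t}` at time `t`. -/
def path (t : ℝ≥0) (ω : Config N) : Path :=
  pathAfter ω (Set.ncard {n | T n ω ≤ (t : ℝ≥0∞)})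

/-- The order book path `(U_i)_{T_i < t}` just before the time `t`. -/
def pathBefore (t : ℝ≥0) (ω : Config N) : Path :=
  pathAfter ω (Set.ncard {n | T n ω < (t : ℝ≥0∞)})

open scoped Classical in
/-- The sum of `φ(e, u, t - T_i, X_i)` over all events, past ones included, with `T_i < t`. -/
def excitation (φ : Event N → State → ℝ≥0 → Event N → ℝ≥0) (t : ℝ≥0) (ω : Config N)
    (e : Event N) (u : State) : ℝ≥0∞ :=
  (∑' k : ℕ, (φ e u (t + age k ω) (pastEvent k ω) : ℝ≥0∞)) +
    ∑' n : ℕ, if T n ω < (t : ℝ≥0∞) then (φ e u (t - (T n ω).toNNReal) (X n ω) : ℝ≥0∞) else 0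

/-- The intensity `λ_t(e) = ψ(e, U_{t-}, t, ∑_{T_i < t} φ(e, U_{t-}, t - T_i, X_i))`.
The value of `ψ` at an infinite last argument is used only where that sum diverges. -/
def intensity (ψ : Event N → State → ℝ≥0 → ℝ≥0∞ → ℝ≥0)
    (φ : Event N → State → ℝ≥0 → Event N → ℝ≥0) (t : ℝ≥0) (ω : Config N) (e : Event N) : ℝ≥0 :=
  ψ e (pathBefore t ω 0) t (excitation φ t ω e (pathBefore t ω 0))

/-- The information available at time `t`: the past at time `0`, and the events up to time `t`. -/
abbrev historySigma (N : ℕ) (t : ℝ≥0) : MeasurableSpace (Config N) :=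
  MeasurableSpace.comap Prod.fst inferInstance ⊔
    MeasurableSpace.generateFrom {A | ∃ (n : ℕ) (C : Set ℝ≥0∞) (B : Set (Event N)),
      MeasurableSet C ∧ C ⊆ Set.Iic (t : ℝ≥0∞) ∧ MeasurableSet B ∧
        A = {ω | T n ω ∈ C ∧ X n ω ∈ B}}

/-- The filtration of the market. -/
def historyFiltration (N : ℕ) :
    Filtration ℝ≥0 (inferInstance : MeasurableSpace (Config N)) where
  seq := historySigma N
  mono' := by
    intro s t hst
    refine sup_le_sup le_rfl (MeasurableSpace.generateFrom_mono ?_)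
    rintro A ⟨n, C, B, hC, hCs, hB, rfl⟩
    exact ⟨n, C, B, hC, hCs.trans (Set.Iic_subset_Iic.2 (by exact_mod_cast hst)), hB, rfl⟩
  le' := by
    intro t
    refine sup_le measurable_fst.comap_le (MeasurableSpace.generateFrom_le ?_)
    rintro A ⟨n, C, B, hC, -, hB, rfl⟩
    have h : Measurable fun ω : Config N => ω.2 n := (measurable_pi_apply n).comp measurable_snd
    exact (h.fst hC).inter (h.snd hB)

open scoped Classical in
/-- `rate` is the intensity, under `P` and for the filtration of the market, of the point process of
events after time `0`: for each event type `e` and each nonnegative predictable process `C`,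
`E[∑ C(T_n) 1{X_n = e}] = E[∫ C(s) rate(s, e) ds]`. -/
def HasIntensity (P : Measure (Config N)) (rate : ℝ≥0 → Config N → Event N → ℝ≥0) : Prop :=
  ∀ (e : Event N) (C : ℝ≥0 × Config N → ℝ≥0∞),
    Measurable[(historyFiltration N).predictable] C →
      ∫⁻ ω, (∑' n : ℕ, if T n ω ≠ ∞ ∧ X n ω = e then C ((T n ω).toNNReal, ω) else 0) ∂P =
        ∫⁻ ω, (∫⁻ s in Set.Ioi (0 : ℝ), C (s.toNNReal, ω) * (rate s.toNNReal ω e : ℝ≥0∞)) ∂P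

/-- `P` is the law of the market started from a past with law `μ`: the events occur in increasing
order and do not accumulate, they move the book according to its dynamics, and their intensity
is `intensity ψ φ`. -/
structure IsMarketLaw (ψ : Event N → State → ℝ≥0 → ℝ≥0∞ → ℝ≥0)
    (φ : Event N → State → ℝ≥0 → Event N → ℝ≥0) (μ : Measure (History N))
    (P : Measure (Config N)) : Prop where
  past_law : P.map Prod.fst = μ
  past_ordered : ∀ᵐ ω ∂P, 0 < age 0 ω ∧ StrictMono fun k => age k ω
  future_ordered : ∀ᵐ ω ∂P, 0 < T 0 ω ∧
    ∀ n, T n ω ≤ T (n + 1) ω ∧ (T n ω ≠ ∞ → T n ω < T (n + 1) ω)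
  no_explosion : ∀ᵐ ω ∂P, Tendsto (fun n => T n ω) atTop (𝓝 ∞)
  past_dynamics : ∀ᵐ ω ∂P, ∀ k, IsUpdate (pastEvent (k + 1) ω).after (pastEvent k ω)
  future_dynamics : ∀ᵐ ω ∂P, ∀ n, T n ω ≠ ∞ → IsUpdate (pathAfter ω n 0) (X n ω)
  hasIntensity : HasIntensity P (intensity ψ φ)

/-- Stationarity of the market under `P`: the joint law of the order book path `(U_i)_{T_i ≤ t}` and
of the intensities `(λ_t(e))_e` does not depend on the time `t`. -/
def IsStationary (ψ : Event N → State → ℝ≥0 → ℝ≥0∞ → ℝ≥0)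
    (φ : Event N → State → ℝ≥0 → Event N → ℝ≥0) (P : Measure (Config N)) : Prop :=
  ∀ t : ℝ≥0, P.map (fun ω => (path t ω, intensity ψ φ t ω)) =
    P.map (fun ω => (path 0 ω, intensity ψ φ 0 ω))

variable {Z : Type*}

/-- The observed process `ζ_t = f((U_i)_{T_i ≤ t})`. -/
def zeta (f : Path → Z) (t : ℝ≥0) (ω : Config N) : Z := f (path t ω)

/-- The event `e`, occurring when the order book path is `p`, leads the observed process from its
current value `f p` directly to `z'`. -/
def Leads (f : Path → Z) (p : Path) (z' : Z) (e : Event N) : Prop :=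
  IsUpdate (p 0) e ∧ f (p.push e.after) = z'

/-- The law `π` of `ζ_0`. -/
def stationaryLaw (f : Path → Z) (P : Measure (Config N)) (z : Z) : ℝ≥0∞ :=
  P {ω | zeta f 0 ω = z}

open scoped Classical in
/-- The mean rate at which the observed process moves from `z` to `z'`: the sum over the events `e`
of the conditional expectation of `λ_0(e) 1{e leads from z to z'}` given `ζ_0 = z`. -/
def jumpRate (ψ : Event N → State → ℝ≥0 → ℝ≥0∞ → ℝ≥0)
    (φ : Event N → State → ℝ≥0 → Event N → ℝ≥0) (f : Path → Z) (P : Measure (Config N))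
    (z z' : Z) : ℝ≥0∞ :=
  ∑' e : Event N, ∫⁻ ω, (if Leads f (path 0 ω) z' e then (intensity ψ φ 0 ω e : ℝ≥0∞) else 0)
    ∂(cond P {ω | zeta f 0 ω = z})

open scoped Classical in
/-- The total mean rate at which the observed process leaves `z`. -/
def exitRate (ψ : Event N → State → ℝ≥0 → ℝ≥0∞ → ℝ≥0)
    (φ : Event N → State → ℝ≥0 → Event N → ℝ≥0) (f : Path → Z) (P : Measure (Config N))
    (z : Z) : ℝ≥0∞ :=
  ∑' z' : Z, if z' = z then 0 else jumpRate ψ φ f P z z'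

open scoped Classical in
/-- The effective generator `Q`: jump rates off the diagonal, minus the exit rates on it. -/
def generator (ψ : Event N → State → ℝ≥0 → ℝ≥0∞ → ℝ≥0)
    (φ : Event N → State → ℝ≥0 → Event N → ℝ≥0) (f : Path → Z) (P : Measure (Config N))
    (z z' : Z) : ℝ :=
  if z' = z then -(exitRate ψ φ f P z).toReal else (jumpRate ψ φ f P z z').toReal

end OrderBook

end

/-!
Over the time interval `(0, 1]`, the number of entries of the observed process `ζ` into a value `z`,
plus `1` if `ζ_0 = z`, equals the number of its exits from `z`, plus `1` if `ζ_1 = z`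
(`sum_entry_add_eq_sum_exit_add`). In expectation the two correction terms are equal, because the law
of `ζ_t` does not depend on `t`, and finite, so they cancel in `[0, ∞]`: the mean number of entries
equals the mean number of exits, whether or not it is finite (`tsum_lintegral_entrySet_eq`).

These mean numbers are the two sides of `π Q = 0`. The indicator that the order book path just before
time `s` lies in a given set is predictable (`measurableSet_predictableSet`), so the definition of the
intensity turns the mean number of events `e` that occur while the path lies in this set into the mean
of the integral of `λ_s(e)` over the times `s` in `(0, 1]` at which it does. Tonelli's theorem and the
stationarity of the joint law of the path and the intensities reduce this integral to its integrand
at time `0` (`lintegral_tsum_indicator_predictableSet`). Summing over the events and decomposing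
according to the value of `ζ` before, or after, the transition gives the flows `π(z') Q(z', z)` into
`z` and `π(z) Q(z, z')` out of `z` (`tsum_stationaryLaw_mul_jumpRate`, `stationaryLaw_mul_exitRate`).
-/

noncomputable section

namespace OrderBook

variable {N : ℕ} {Z : Type*}

/-! ### Measurability of the path and of the intensity -/

instance : DiscreteMeasurableSpace State := ⟨fun _ => trivial⟩

instance : DiscreteMeasurableSpace (Event N) := ⟨fun _ => trivial⟩

instance : Countable Side :=
  Function.Injective.countable (f := fun i : Side => (i matches .bid)) (by
    intro i j h
    cases i <;> cases j <;> simp_all)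

instance : Countable State :=
  Function.Injective.countable (f := fun u : State => (u.bid, u.ask, u.spread)) (by
    rintro ⟨a, b, c, h⟩ ⟨a', b', c', h'⟩ h
    simp_all)

instance : Countable (Event N) :=
  Function.Injective.countable
    (f := fun e : Event N => (e.size, e.price, e.dir, e.side, e.depleted, e.after, e.agent)) (by
    rintro ⟨a, b, c, d, k, l, m⟩ ⟨a', b', c', d', k', l', m'⟩ h
    simp_all)

lemma measurable_T (n : ℕ) : Measurable (T (N := N) n) :=
  ((measurable_pi_apply n).comp measurable_snd).fst

lemma measurable_X (n : ℕ) : Measurable (X (N := N) n) :=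
  ((measurable_pi_apply n).comp measurable_snd).snd

lemma measurable_age (k : ℕ) : Measurable (age (N := N) k) :=
  ((measurable_pi_apply k).comp measurable_fst).fst

lemma measurable_pastEvent (k : ℕ) : Measurable (pastEvent (N := N) k) :=
  ((measurable_pi_apply k).comp measurable_fst).snd

lemma measurable_push (u : State) : Measurable fun p : Path => p.push u := by
  refine measurable_pi_lambda _ fun k => ?_
  cases k with
  | zero => exact measurable_const
  | succ k => exact measurable_pi_apply k

lemma measurable_push_uncurry : Measurable fun q : Path × State => q.1.push q.2 :=
  measurable_from_prod_countable_left measurable_push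

lemma measurable_pathAfter (m : ℕ) : Measurable fun ω : Config N => pathAfter ω m := by
  induction m with
  | zero =>
    exact measurable_pi_lambda _ fun k => Measurable.of_discrete.comp (measurable_pastEvent k)
  | succ m ih =>
    exact measurable_push_uncurry.comp
      (ih.prodMk ((Measurable.of_discrete (f := Event.after)).comp (measurable_X m)))

lemma measurable_pathAfter_uncurry :
    Measurable fun q : Config N × ℕ => pathAfter q.1 q.2 :=
  measurable_from_prod_countable_left measurable_pathAfter

lemma measurable_path_uncurry : Measurable fun q : ℝ≥0 × Config N => path q.1 q.2 := by
  refine measurable_pathAfter_uncurry.comp (measurable_snd.prodMk (measurable_ncard.comp ?_))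
  refine measurable_set_iff.2 fun n => measurableSet_setOfPred.1 ?_
  exact measurableSet_le ((measurable_T n).comp measurable_snd)
    (measurable_coe_nnreal_ennreal.comp measurable_fst)

lemma measurable_pathBefore_uncurry :
    Measurable fun q : ℝ≥0 × Config N => pathBefore q.1 q.2 := by
  refine measurable_pathAfter_uncurry.comp (measurable_snd.prodMk (measurable_ncard.comp ?_))
  refine measurable_set_iff.2 fun n => measurableSet_setOfPred.1 ?_
  exact measurableSet_lt ((measurable_T n).comp measurable_snd)
    (measurable_coe_nnreal_ennreal.comp measurable_fst)

lemma measurable_path (t : ℝ≥0) : Measurable (path (N := N) t) :=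
  measurable_path_uncurry.comp measurable_prodMk_left

lemma measurable_excitation_uncurry {φ : Event N → State → ℝ≥0 → Event N → ℝ≥0}
    (hφ : ∀ e u x, Measurable fun s : ℝ≥0 => φ e u s x) (e : Event N) (u : State) :
    Measurable fun q : ℝ≥0 × Config N => excitation φ q.1 q.2 e u := by
  have hφ' : Measurable fun r : ℝ≥0 × Event N => (φ e u r.1 r.2 : ℝ≥0∞) :=
    measurable_coe_nnreal_ennreal.comp (measurable_from_prod_countable_left (hφ e u))
  refine (Measurable.tsum fun k => ?_).add (Measurable.tsum fun n => ?_)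
  · exact hφ'.comp ((measurable_fst.add ((measurable_age k).comp measurable_snd)).prodMk
      ((measurable_pastEvent k).comp measurable_snd))
  · have hT : Measurable fun q : ℝ≥0 × Config N => T n q.2 := (measurable_T n).comp measurable_snd
    refine Measurable.ite (measurableSet_lt hT (measurable_coe_nnreal_ennreal.comp measurable_fst))
      (hφ'.comp ((measurable_fst.sub hT.ennreal_toNNReal).prodMk
        ((measurable_X n).comp measurable_snd))) measurable_const

lemma measurable_intensity_uncurry {ψ : Event N → State → ℝ≥0 → ℝ≥0∞ → ℝ≥0}
    (hψ : ∀ e u, Measurable fun p : ℝ≥0 × ℝ≥0∞ => ψ e u p.1 p.2)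
    {φ : Event N → State → ℝ≥0 → Event N → ℝ≥0}
    (hφ : ∀ e u x, Measurable fun s : ℝ≥0 => φ e u s x) (e : Event N) :
    Measurable fun q : ℝ≥0 × Config N => intensity ψ φ q.1 q.2 e := by
  have h : Measurable fun r : (ℝ≥0 × Config N) × State =>
      ψ e r.2 r.1.1 (excitation φ r.1.1 r.1.2 e r.2) :=
    measurable_from_prod_countable_left fun u =>
      (hψ e u).comp (measurable_fst.prodMk (measurable_excitation_uncurry hφ e u))
  exact h.comp (measurable_id.prodMk
    ((measurable_pi_apply 0).comp measurable_pathBefore_uncurry))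

lemma measurable_intensity {ψ : Event N → State → ℝ≥0 → ℝ≥0∞ → ℝ≥0}
    (hψ : ∀ e u, Measurable fun p : ℝ≥0 × ℝ≥0∞ => ψ e u p.1 p.2)
    {φ : Event N → State → ℝ≥0 → Event N → ℝ≥0}
    (hφ : ∀ e u x, Measurable fun s : ℝ≥0 => φ e u s x) (t : ℝ≥0) :
    Measurable (intensity ψ φ t) :=
  measurable_pi_lambda _ fun e =>
    (measurable_intensity_uncurry hψ hφ e).comp measurable_prodMk_left

lemma measurable_intensity_apply {ψ : Event N → State → ℝ≥0 → ℝ≥0∞ → ℝ≥0}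
    (hψ : ∀ e u, Measurable fun p : ℝ≥0 × ℝ≥0∞ => ψ e u p.1 p.2)
    {φ : Event N → State → ℝ≥0 → Event N → ℝ≥0}
    (hφ : ∀ e u x, Measurable fun s : ℝ≥0 => φ e u s x) (t : ℝ≥0) (e : Event N) :
    Measurable fun ω => (intensity ψ φ t ω e : ℝ≥0∞) :=
  measurable_coe_nnreal_ennreal.comp
    ((measurable_pi_apply e).comp (measurable_intensity hψ hφ t))

/-! ### Predictability of the path before the current time -/

lemma predictable_le_prod :
    (historyFiltration N).predictable ≤ (inferInstance : MeasurableSpace (ℝ≥0 × Config N)) := by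
  refine measurableSpace_le_predictable_of_measurableSet (fun A hA => ?_) fun i A hA => ?_
  · exact (measurableSet_singleton _).prod ((historyFiltration N).le _ A hA)
  · exact measurableSet_Ioi.prod ((historyFiltration N).le _ A hA)

/-- An event that happened before the current time `s` happened before some rational time smaller
than `s`, at which its mark is already known. -/
lemma measurableSet_predictable_T_lt (n : ℕ) (B : Set (Event N)) :
    MeasurableSet[(historyFiltration N).predictable]
      {q : ℝ≥0 × Config N | T n q.2 < (q.1 : ℝ≥0∞) ∧ X n q.2 ∈ B} := by
  have h : {q : ℝ≥0 × Config N | T n q.2 < (q.1 : ℝ≥0∞) ∧ X n q.2 ∈ B} =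
      ⋃ r : ℚ, Set.Ioi (r : ℝ).toNNReal ×ˢ
        {ω | T n ω ∈ Set.Iic ((r : ℝ).toNNReal : ℝ≥0∞) ∧ X n ω ∈ B} := by
    ext ⟨s, ω⟩
    simp only [Set.mem_ofPred_eq, Set.mem_iUnion, Set.mem_prod, Set.mem_Ioi, Set.mem_Iic]
    constructor
    · rintro ⟨h1, h2⟩
      obtain ⟨r, -, hr1, hr2⟩ := ENNReal.lt_iff_exists_rat_btwn.1 h1
      exact ⟨r, by exact_mod_cast hr2, hr1.le, h2⟩
    · rintro ⟨r, h1, h2, h3⟩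
      exact ⟨h2.trans_lt (by exact_mod_cast h1), h3⟩
  rw [h]
  refine MeasurableSet.iUnion fun r => measurableSet_predictable_Ioi_prod ?_
  refine (le_sup_right : _ ≤ historySigma N (r : ℝ).toNNReal) _
    (MeasurableSpace.measurableSet_generateFrom ?_)
  exact ⟨n, _, B, measurableSet_Iic, le_rfl, trivial, rfl⟩

lemma measurableSet_predictable_pathAfter (m : ℕ) {A : Set Path} (hA : MeasurableSet A) :
    MeasurableSet[(historyFiltration N).predictable]
      {q : ℝ≥0 × Config N | 0 < q.1 ∧ (∀ i < m, T i q.2 < (q.1 : ℝ≥0∞)) ∧ pathAfter q.2 m ∈ A} := by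
  induction m generalizing A with
  | zero =>
    have h : {q : ℝ≥0 × Config N |
        0 < q.1 ∧ (∀ i < 0, T i q.2 < (q.1 : ℝ≥0∞)) ∧ pathAfter q.2 0 ∈ A} =
        Set.Ioi 0 ×ˢ {ω | pathAfter ω 0 ∈ A} := by
      ext q
      simp
    rw [h]
    refine measurableSet_predictable_Ioi_prod ?_
    refine (le_sup_left : _ ≤ historySigma N 0) _ ?_
    have hg : Measurable fun (h : History N) (k : ℕ) => (h k).2.after :=
      measurable_pi_lambda _ fun k =>
        (Measurable.of_discrete (f := Event.after)).comp (measurable_pi_apply k).snd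
    exact ⟨_, hg hA, rfl⟩
  | succ m ih =>
    have h : {q : ℝ≥0 × Config N | 0 < q.1 ∧ (∀ i < m + 1, T i q.2 < (q.1 : ℝ≥0∞)) ∧
          pathAfter q.2 (m + 1) ∈ A} =
        ⋃ u : State, {q : ℝ≥0 × Config N | 0 < q.1 ∧ (∀ i < m, T i q.2 < (q.1 : ℝ≥0∞)) ∧
          pathAfter q.2 m ∈ (fun p : Path => p.push u) ⁻¹' A} ∩
          {q | T m q.2 < (q.1 : ℝ≥0∞) ∧ X m q.2 ∈ {e | e.after = u}} := by
      ext q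
      simp only [Nat.forall_lt_succ_right, pathAfter, Set.mem_ofPred_eq, Set.mem_iUnion,
        Set.mem_inter_iff, Set.mem_preimage]
      constructor
      · rintro ⟨h0, ⟨h1, h2⟩, h3⟩
        exact ⟨_, ⟨h0, h1, h3⟩, h2, rfl⟩
      · rintro ⟨u, ⟨h0, h1, h3⟩, h2, rfl⟩
        exact ⟨h0, ⟨h1, h2⟩, h3⟩
    rw [h]
    exact MeasurableSet.iUnion fun u =>
      (ih (measurable_push u hA)).inter (measurableSet_predictable_T_lt m _)

/-- The predictable set of the pairs `(s, ω)` with `0 < s ≤ 1` for which the path just before `s`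
lies in `A`. It is written in terms of the times of the events, rather than with `pathBefore`, so as
to be predictable also off the almost sure event that these times are ordered. -/
def predictableSet (N : ℕ) (A : Set Path) : Set (ℝ≥0 × Config N) :=
  {q | q.1 ≤ 1} ∩ ⋃ m : ℕ,
    {q | 0 < q.1 ∧ (∀ i < m, T i q.2 < (q.1 : ℝ≥0∞)) ∧ pathAfter q.2 m ∈ A} ∩
      {q | (q.1 : ℝ≥0∞) ≤ T m q.2}

lemma measurableSet_predictableSet {A : Set Path} (hA : MeasurableSet A) :
    MeasurableSet[(historyFiltration N).predictable] (predictableSet N A) := by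
  refine MeasurableSet.inter ?_ (MeasurableSet.iUnion fun m =>
    (measurableSet_predictable_pathAfter m hA).inter ?_)
  · have h := (measurableSet_predictable_Ioi_prod (𝓕 := historyFiltration N) (i := 1)
      MeasurableSet.univ).compl
    convert h using 1
    ext q
    simp
  · convert (measurableSet_predictable_T_lt (N := N) m Set.univ).compl using 1
    ext q
    simp

/-! ### Ordered sequences of events -/

/-- The events after time `0` are strictly ordered, as long as their times are finite, and do not
accumulate. -/
structure IsRegular (ω : Config N) : Prop where
  pos : 0 < T 0 ω
  le_succ : ∀ n, T n ω ≤ T (n + 1) ω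
  lt_succ : ∀ n, T n ω ≠ ∞ → T n ω < T (n + 1) ω
  tendsto : Tendsto (fun n => T n ω) atTop (𝓝 ∞)

namespace IsRegular

variable {ω : Config N}

lemma monotone (h : IsRegular ω) : Monotone fun n => T n ω := monotone_nat_of_le_succ h.le_succ

lemma lt_of_lt (h : IsRegular ω) {k n : ℕ} (hkn : k < n) (hn : T n ω ≠ ∞) : T k ω < T n ω :=
  (h.lt_succ k (ne_top_of_le_ne_top hn (h.monotone hkn.le))).trans_le (h.monotone hkn)

/-- Before a finite time there are the events numbered by an initial segment of `ℕ`. -/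
lemma exists_eq_Iio (h : IsRegular ω) (s : ℝ≥0) {p : ℝ≥0∞ → Prop}
    (hp : ∀ a b, a ≤ b → p b → p a) (hps : ∀ a, p a → a ≤ s) :
    ∃ m, {n | p (T n ω)} = Set.Iio m := by
  classical
  have hex : ∃ n, ¬ p (T n ω) := by
    obtain ⟨n, hn⟩ := (h.tendsto.eventually (lt_mem_nhds (ENNReal.coe_lt_top (r := s)))).exists
    exact ⟨n, fun hpn => (hps _ hpn).not_gt hn⟩
  refine ⟨Nat.find hex, Set.ext fun n => ⟨fun hn => ?_, fun hn => ?_⟩⟩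
  · by_contra hlt
    exact Nat.find_spec hex (hp _ _ (h.monotone (not_lt.1 hlt)) hn)
  · exact not_not.1 (Nat.find_min hex hn)

lemma exists_lt_eq_Iio (h : IsRegular ω) (s : ℝ≥0) :
    ∃ m, {n | T n ω < (s : ℝ≥0∞)} = Set.Iio m :=
  h.exists_eq_Iio s (p := fun a => a < s) (fun _ _ hab hb => hab.trans_lt hb) fun _ ha => ha.le

lemma exists_le_eq_Iio (h : IsRegular ω) (s : ℝ≥0) :
    ∃ m, {n | T n ω ≤ (s : ℝ≥0∞)} = Set.Iio m :=
  h.exists_eq_Iio s (p := fun a => a ≤ s) (fun _ _ hab hb => hab.trans hb) fun _ ha => ha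

lemma path_eq {s : ℝ≥0} {m : ℕ} (hm : {n | T n ω ≤ (s : ℝ≥0∞)} = Set.Iio m) :
    path s ω = pathAfter ω m := by
  rw [path, hm, ← Finset.coe_range, Set.ncard_coe_finset, Finset.card_range]

lemma pathBefore_eq {s : ℝ≥0} {m : ℕ} (hm : {n | T n ω < (s : ℝ≥0∞)} = Set.Iio m) :
    pathBefore s ω = pathAfter ω m := by
  rw [pathBefore, hm, ← Finset.coe_range, Set.ncard_coe_finset, Finset.card_range]

lemma path_zero (h : IsRegular ω) : path 0 ω = pathAfter ω 0 := by
  refine path_eq (Set.ext fun n => ?_)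
  simpa using (h.pos.trans_le (h.monotone (Nat.zero_le n))).ne'

lemma pathBefore_toNNReal_T (h : IsRegular ω) {n : ℕ} (hn : T n ω ≠ ∞) :
    pathBefore (T n ω).toNNReal ω = pathAfter ω n := by
  refine pathBefore_eq (Set.ext fun k => ?_)
  simp only [ENNReal.coe_toNNReal hn, Set.mem_ofPred_eq, Set.mem_Iio]
  exact ⟨fun hk => not_le.1 fun hnk => (h.monotone hnk).not_gt hk, fun hk => h.lt_of_lt hk hn⟩

lemma pathBefore_eq_path {s : ℝ≥0} (hs : ∀ n, T n ω ≠ s) : pathBefore s ω = path s ω := by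
  simp only [pathBefore, path, le_iff_lt_or_eq, hs, or_false]

lemma mem_predictableSet (h : IsRegular ω) {A : Set Path} {s : ℝ≥0} :
    (s, ω) ∈ predictableSet N A ↔ 0 < s ∧ s ≤ 1 ∧ pathBefore s ω ∈ A := by
  obtain ⟨m, hm⟩ := h.exists_lt_eq_Iio s
  have hlt : ∀ n, T n ω < s ↔ n < m := fun n => Set.ext_iff.1 hm n
  simp only [predictableSet, Set.mem_inter_iff, Set.mem_ofPred_eq, Set.mem_iUnion,
    pathBefore_eq hm, hlt, ← not_lt (a := T _ ω)]
  constructor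
  · rintro ⟨h1, k, ⟨h2, h3, h4⟩, h5⟩
    obtain rfl : k = m :=
      le_antisymm (not_lt.1 fun hmk => lt_irrefl _ (h3 m hmk)) (not_lt.1 h5)
    exact ⟨h2, h1, h4⟩
  · rintro ⟨h1, h2, h3⟩
    exact ⟨h2, m, ⟨h1, fun i hi => hi, h3⟩, lt_irrefl m⟩

end IsRegular

variable {ψ : Event N → State → ℝ≥0 → ℝ≥0∞ → ℝ≥0}
  {φ : Event N → State → ℝ≥0 → Event N → ℝ≥0} {μ : Measure (History N)} {P : Measure (Config N)}

/-! ### Mean number of events on the unit time interval -/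

lemma IsMarketLaw.isProbabilityMeasure [IsProbabilityMeasure μ] (hP : IsMarketLaw ψ φ μ P) :
    IsProbabilityMeasure P := by
  refine ⟨?_⟩
  have h : P.map Prod.fst Set.univ = 1 := by
    rw [hP.past_law]
    exact measure_univ
  rwa [Measure.map_apply measurable_fst MeasurableSet.univ, Set.preimage_univ] at h

lemma IsMarketLaw.ae_isRegular (hP : IsMarketLaw ψ φ μ P) : ∀ᵐ ω ∂P, IsRegular ω := by
  filter_upwards [hP.future_ordered, hP.no_explosion] with ω h1 h2
  exact ⟨h1.1, fun n => (h1.2 n).1, fun n => (h1.2 n).2, h2⟩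

lemma IsStationary.lintegral_eq (hstat : IsStationary ψ φ P)
    (hψ : ∀ e u, Measurable fun p : ℝ≥0 × ℝ≥0∞ => ψ e u p.1 p.2)
    (hφ : ∀ e u x, Measurable fun s : ℝ≥0 => φ e u s x)
    {G : Path × (Event N → ℝ≥0) → ℝ≥0∞} (hG : Measurable G) (t : ℝ≥0) :
    ∫⁻ ω, G (path t ω, intensity ψ φ t ω) ∂P = ∫⁻ ω, G (path 0 ω, intensity ψ φ 0 ω) ∂P := by
  have hm : ∀ t, Measurable fun ω : Config N => (path t ω, intensity ψ φ t ω) := fun t =>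
    (measurable_path t).prodMk (measurable_intensity hψ hφ t)
  rw [← lintegral_map hG (hm t), hstat t, lintegral_map hG (hm 0)]

/-- At the time of the event number `n`, the predictable path is the one left by the events before
it. -/
lemma IsRegular.indicator_predictableSet {ω : Config N} (h : IsRegular ω) {A : Set Path} {n : ℕ}
    (hn : T n ω ≠ ∞) :
    (predictableSet N A).indicator (1 : ℝ≥0 × Config N → ℝ≥0∞) ((T n ω).toNNReal, ω) =
      {k | T k ω ≤ 1 ∧ pathAfter ω k ∈ A}.indicator 1 n := by
  have hpos : 0 < (T n ω).toNNReal :=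
    ENNReal.toNNReal_pos (h.pos.trans_le (h.monotone (Nat.zero_le n))).ne' hn
  have hle : (T n ω).toNNReal ≤ 1 ↔ T n ω ≤ 1 := by
    rw [← ENNReal.coe_le_coe, ENNReal.coe_toNNReal hn, ENNReal.coe_one]
  classical
  simp only [Set.indicator_apply, h.mem_predictableSet, h.pathBefore_toNNReal_T hn, hpos, hle,
    true_and, Set.mem_ofPred_eq, Pi.one_apply]

open scoped Classical in
/-- By stationarity, the mean number of events `e` that occur in the unit time interval while the
path lies in `A` is the mean of `λ_0(e)` on the event that the path lies in `A`. -/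
lemma lintegral_tsum_indicator_predictableSet (hP : IsMarketLaw ψ φ μ P) [SFinite P]
    (hψ : ∀ e u, Measurable fun p : ℝ≥0 × ℝ≥0∞ => ψ e u p.1 p.2)
    (hφ : ∀ e u x, Measurable fun s : ℝ≥0 => φ e u s x) (hstat : IsStationary ψ φ P)
    (e : Event N) {A : Set Path} (hA : MeasurableSet A) :
    ∫⁻ ω, (∑' n : ℕ, if T n ω ≠ ∞ ∧ X n ω = e then
        (predictableSet N A).indicator (1 : ℝ≥0 × Config N → ℝ≥0∞) ((T n ω).toNNReal, ω) else 0) ∂P =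
      ∫⁻ ω, A.indicator (fun _ => (intensity ψ φ 0 ω e : ℝ≥0∞)) (path 0 ω) ∂P := by
  rw [hP.hasIntensity e ((predictableSet N A).indicator (1 : ℝ≥0 × Config N → ℝ≥0∞))
    (Measurable.indicator (m := (historyFiltration N).predictable) measurable_const
      (measurableSet_predictableSet hA))]
  -- Just before and at time `s`, the paths coincide unless `s` is one of the countably many `T n`.
  have h1 : ∀ᵐ ω ∂P, ∫⁻ s in Set.Ioi (0 : ℝ),
        (predictableSet N A).indicator (1 : ℝ≥0 × Config N → ℝ≥0∞) (s.toNNReal, ω) *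
          (intensity ψ φ s.toNNReal ω e : ℝ≥0∞) =
      ∫⁻ s in Set.Ioc (0 : ℝ) 1,
        A.indicator (fun _ => (intensity ψ φ s.toNNReal ω e : ℝ≥0∞)) (path s.toNNReal ω) := by
    filter_upwards [hP.ae_isRegular] with ω hω
    have hcount : (Set.range fun n => (T n ω).toReal).Countable := Set.countable_range _
    rw [← lintegral_indicator measurableSet_Ioi, ← lintegral_indicator measurableSet_Ioc]
    refine lintegral_congr_ae ?_
    filter_upwards [hcount.ae_notMem volume] with s hs
    by_cases h0 : 0 < s
    · have hne : ∀ n, T n ω ≠ (s.toNNReal : ℝ≥0∞) := fun n hn => hs ⟨n, by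
        simp [hn, h0.le]⟩
      have hs1 : s.toNNReal ≤ 1 ↔ s ≤ 1 := by
        rw [Real.toNNReal_le_iff_le_coe, NNReal.coe_one]
      simp only [Set.indicator_apply, Set.mem_Ioi, h0, if_true, hω.mem_predictableSet,
        Real.toNNReal_pos, hs1, true_and, Set.mem_Ioc, IsRegular.pathBefore_eq_path hne,
        Pi.one_apply, ite_mul, one_mul, zero_mul, ite_and]
    · simp [h0]
  rw [lintegral_congr_ae h1, lintegral_lintegral_swap]
  · have h2 : ∀ s : ℝ≥0, ∫⁻ ω, A.indicator (fun _ => (intensity ψ φ s ω e : ℝ≥0∞)) (path s ω) ∂P =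
        ∫⁻ ω, A.indicator (fun _ => (intensity ψ φ 0 ω e : ℝ≥0∞)) (path 0 ω) ∂P := by
      intro s
      refine hstat.lintegral_eq hψ hφ
        (G := fun q => A.indicator (fun _ => (q.2 e : ℝ≥0∞)) q.1) ?_ s
      exact Measurable.ite (measurable_fst hA)
        (measurable_coe_nnreal_ennreal.comp ((measurable_pi_apply e).comp measurable_snd))
        measurable_const
    simp only [h2, lintegral_const, Measure.restrict_apply MeasurableSet.univ, Set.univ_inter,
      Real.volume_Ioc, sub_zero, ENNReal.ofReal_one, mul_one]
  · refine Measurable.aemeasurable ?_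
    have hq : Measurable fun q : Config N × ℝ => (q.2.toNNReal, q.1) :=
      (measurable_real_toNNReal.comp measurable_snd).prodMk measurable_fst
    exact Measurable.ite ((measurable_path_uncurry.comp hq) hA)
      (measurable_coe_nnreal_ennreal.comp ((measurable_intensity_uncurry hψ hφ e).comp hq))
      measurable_const

/-- The mean number of events of the unit time interval that occur while the path lies in the set
`A e` attached to the type `e` of the event. -/
lemma lintegral_tsum_event_eq (hP : IsMarketLaw ψ φ μ P) [SFinite P]
    (hψ : ∀ e u, Measurable fun p : ℝ≥0 × ℝ≥0∞ => ψ e u p.1 p.2)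
    (hφ : ∀ e u x, Measurable fun s : ℝ≥0 => φ e u s x) (hstat : IsStationary ψ φ P)
    {A : Event N → Set Path} (hA : ∀ e, MeasurableSet (A e)) :
    ∫⁻ ω, ∑' n : ℕ, {k | T k ω ≤ 1 ∧ pathAfter ω k ∈ A (X k ω)}.indicator 1 n ∂P =
      ∑' e, ∫⁻ ω, (A e).indicator (fun _ => (intensity ψ φ 0 ω e : ℝ≥0∞)) (path 0 ω) ∂P := by
  classical
  simp_rw [← lintegral_tsum_indicator_predictableSet hP hψ hφ hstat _ (hA _)]
  rw [← lintegral_tsum]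
  · refine lintegral_congr_ae ?_
    filter_upwards [hP.ae_isRegular] with ω hω
    rw [ENNReal.tsum_comm]
    refine tsum_congr fun n => ?_
    rw [tsum_eq_single (X n ω)]
    · by_cases hn : T n ω = ∞
      · simp [hn]
      · simp [hn, hω.indicator_predictableSet hn, Set.indicator_apply]
    · intro e he
      simp [he.symm]
  · intro e
    refine (Measurable.tsum fun n => Measurable.ite ?_ ?_ measurable_const).aemeasurable
    · exact ((measurable_T n) (measurableSet_singleton ∞).compl).inter
        ((measurable_X n) (measurableSet_singleton e))
    · have hC : Measurable ((predictableSet N (A e)).indicator (1 : ℝ≥0 × Config N → ℝ≥0∞)) :=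
        measurable_one.indicator (predictable_le_prod _ (measurableSet_predictableSet (hA e)))
      exact hC.comp ((measurable_T n).ennreal_toNNReal.prodMk measurable_id)

/-! ### Balance of the flows -/

/-- The paths at which the event `e` makes the observed process enter `z`. -/
def entrySet (f : Path → Z) (z : Z) (e : Event N) : Set Path := {p | f p ≠ z ∧ Leads f p z e}

/-- The paths at which the event `e` makes the observed process leave `z`. -/
def exitSet (f : Path → Z) (z : Z) (e : Event N) : Set Path :=
  {p | f p = z ∧ IsUpdate (p 0) e ∧ f (p.push e.after) ≠ z}

lemma measurableSet_isUpdate (e : Event N) : MeasurableSet {p : Path | IsUpdate (p 0) e} :=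
  (measurable_pi_apply (X := fun _ : ℕ => State) 0)
    (MeasurableSet.of_discrete (s := {u : State | IsUpdate u e}))

lemma measurableSet_leads [MeasurableSpace Z] [MeasurableSingletonClass Z] {f : Path → Z}
    (hf : Measurable f) (z : Z) (e : Event N) : MeasurableSet {p : Path | Leads f p z e} :=
  (measurableSet_isUpdate e).inter ((hf.comp (measurable_push e.after)) (measurableSet_singleton z))

lemma measurableSet_entrySet [MeasurableSpace Z] [MeasurableSingletonClass Z] {f : Path → Z}
    (hf : Measurable f) (z : Z) (e : Event N) : MeasurableSet (entrySet f z e) :=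
  (hf (measurableSet_singleton z).compl).inter (measurableSet_leads hf z e)

lemma measurableSet_exitSet [MeasurableSpace Z] [MeasurableSingletonClass Z] {f : Path → Z}
    (hf : Measurable f) (z : Z) (e : Event N) : MeasurableSet (exitSet f z e) :=
  (hf (measurableSet_singleton z)).inter ((measurableSet_isUpdate e).inter
    ((hf.comp (measurable_push e.after)) (measurableSet_singleton z).compl))

open scoped Classical in
/-- Along the first `m` events, the observed process enters and leaves `z` equally often, up to a
correction by `1` for starting in `z` and for ending in `z`. -/
lemma sum_entry_add_eq_sum_exit_add (f : Path → Z) (z : Z) (ω : Config N) (m : ℕ)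
    (h : ∀ n < m, IsUpdate (pathAfter ω n 0) (X n ω)) :
    (∑ n ∈ Finset.range m, if pathAfter ω n ∈ entrySet f z (X n ω) then (1 : ℝ≥0∞) else 0) +
        (if f (pathAfter ω 0) = z then 1 else 0) =
      (∑ n ∈ Finset.range m, if pathAfter ω n ∈ exitSet f z (X n ω) then (1 : ℝ≥0∞) else 0) +
        (if f (pathAfter ω m) = z then 1 else 0) := by
  induction m with
  | zero => simp
  | succ m ih =>
    have ih := ih fun n hn => h n (hn.trans m.lt_succ_self)
    have hm := h m m.lt_succ_self
    have hstep : (if pathAfter ω m ∈ entrySet f z (X m ω) then (1 : ℝ≥0∞) else 0) +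
          (if f (pathAfter ω m) = z then 1 else 0) =
        (if pathAfter ω m ∈ exitSet f z (X m ω) then (1 : ℝ≥0∞) else 0) +
          (if f (pathAfter ω (m + 1)) = z then 1 else 0) := by
      by_cases h1 : f (pathAfter ω m) = z <;>
        by_cases h2 : f ((pathAfter ω m).push (X m ω).after) = z <;>
        simp [entrySet, exitSet, Leads, pathAfter, hm, h1, h2]
    rw [Finset.sum_range_succ, Finset.sum_range_succ, add_right_comm, ih, add_right_comm, add_assoc,
      add_assoc, ← hstep]

lemma tsum_indicator_eq_sum {ω : Config N} {m : ℕ} (hm : {n | T n ω ≤ 1} = Set.Iio m)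
    (A : Event N → Set Path) [∀ n, Decidable (pathAfter ω n ∈ A (X n ω))] :
    ∑' n : ℕ, {k | T k ω ≤ 1 ∧ pathAfter ω k ∈ A (X k ω)}.indicator (1 : ℕ → ℝ≥0∞) n =
      ∑ n ∈ Finset.range m, if pathAfter ω n ∈ A (X n ω) then (1 : ℝ≥0∞) else 0 := by
  classical
  have hle : ∀ n, T n ω ≤ 1 ↔ n < m := fun n => Set.ext_iff.1 hm n
  rw [tsum_eq_sum (s := Finset.range m)]
  · refine Finset.sum_congr rfl fun n hn => ?_
    simp [Set.indicator_apply, hle, Finset.mem_range.1 hn]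
  · intro n hn
    simp_all

/-- The mean rate of entries into `z` equals the mean rate of exits from `z`. Both are mean numbers
of transitions in the unit time interval, which differ by `P(ζ_1 = z) - P(ζ_0 = z) = 0`; as these
probabilities are finite, they cancel even if the rates are infinite. -/
lemma tsum_lintegral_entrySet_eq [IsProbabilityMeasure μ] [MeasurableSpace Z]
    [MeasurableSingletonClass Z] (hP : IsMarketLaw ψ φ μ P)
    (hψ : ∀ e u, Measurable fun p : ℝ≥0 × ℝ≥0∞ => ψ e u p.1 p.2)
    (hφ : ∀ e u x, Measurable fun s : ℝ≥0 => φ e u s x) (hstat : IsStationary ψ φ P)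
    {f : Path → Z} (hf : Measurable f) (z : Z) :
    ∑' e, ∫⁻ ω, (entrySet f z e).indicator
        (fun _ => (intensity ψ φ 0 ω e : ℝ≥0∞)) (path 0 ω) ∂P =
      ∑' e, ∫⁻ ω, (exitSet f z e).indicator
        (fun _ => (intensity ψ φ 0 ω e : ℝ≥0∞)) (path 0 ω) ∂P := by
  classical
  have := hP.isProbabilityMeasure
  rw [← lintegral_tsum_event_eq hP hψ hφ hstat (measurableSet_entrySet hf z),
    ← lintegral_tsum_event_eq hP hψ hφ hstat (measurableSet_exitSet hf z)]
  have hg : Measurable fun q : Path × (Event N → ℝ≥0) => if f q.1 = z then (1 : ℝ≥0∞) else 0 :=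
    Measurable.ite ((hf.comp measurable_fst) (measurableSet_singleton z)) measurable_const
      measurable_const
  have hmeas : ∀ t, Measurable fun ω : Config N => if f (path t ω) = z then (1 : ℝ≥0∞) else 0 :=
    fun t => Measurable.ite ((hf.comp (measurable_path t)) (measurableSet_singleton z))
      measurable_const measurable_const
  have hstat1 := hstat.lintegral_eq hψ hφ hg 1
  have hfin : ∫⁻ ω, (if f (path 0 ω) = z then (1 : ℝ≥0∞) else 0) ∂P ≠ ∞ := by
    refine ne_top_of_le_ne_top (measure_ne_top P Set.univ) ?_
    rw [← lintegral_one]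
    exact lintegral_mono fun ω => by split_ifs <;> simp
  refine (ENNReal.add_left_inj hfin).1 ?_
  nth_rewrite 2 [← hstat1]
  rw [← lintegral_add_right _ (hmeas 0), ← lintegral_add_right _ (hmeas 1)]
  refine lintegral_congr_ae ?_
  filter_upwards [hP.ae_isRegular, hP.future_dynamics] with ω hω hdyn
  obtain ⟨m, hm⟩ := hω.exists_le_eq_Iio 1
  rw [hω.path_zero, IsRegular.path_eq hm]
  have hm' : {n | T n ω ≤ 1} = Set.Iio m := by simpa using hm
  rw [tsum_indicator_eq_sum hm', tsum_indicator_eq_sum hm']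
  refine sum_entry_add_eq_sum_exit_add f z ω m fun n hn => hdyn n ?_
  exact ne_top_of_le_ne_top ENNReal.one_ne_top ((Set.ext_iff.1 hm' n).2 hn)

/-! ### The effective generator -/

lemma measurableSet_zeta_eq [MeasurableSpace Z] [MeasurableSingletonClass Z] {f : Path → Z}
    (hf : Measurable f) (t : ℝ≥0) (z : Z) : MeasurableSet {ω : Config N | zeta f t ω = z} :=
  (hf.comp (measurable_path t)) (measurableSet_singleton z)

/-- This holds also if `ζ_0 = z` has probability `0`, where `cond` is the zero measure. -/
lemma stationaryLaw_mul_lintegral_cond [IsFiniteMeasure P] (f : Path → Z) (z : Z)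
    (g : Config N → ℝ≥0∞) :
    stationaryLaw f P z * ∫⁻ ω, g ω ∂(cond P {ω | zeta f 0 ω = z}) =
      ∫⁻ ω in {ω | zeta f 0 ω = z}, g ω ∂P := by
  rw [stationaryLaw, ProbabilityTheory.cond, lintegral_smul_measure, smul_eq_mul, ← mul_assoc]
  by_cases h : P {ω | zeta f 0 ω = z} = 0
  · rw [h, zero_mul, zero_mul, Measure.restrict_eq_zero.2 h, lintegral_zero_measure]
  · rw [ENNReal.mul_inv_cancel h (measure_ne_top _ _), one_mul]

lemma lintegral_cond_ne_top [IsFiniteMeasure P] {f : Path → Z} (z : Z) {g : Config N → ℝ≥0∞}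
    (hg : ∫⁻ ω, g ω ∂P ≠ ∞) : ∫⁻ ω, g ω ∂(cond P {ω | zeta f 0 ω = z}) ≠ ∞ := by
  rw [ProbabilityTheory.cond, lintegral_smul_measure, smul_eq_mul]
  by_cases h : P {ω | zeta f 0 ω = z} = 0
  · simp [Measure.restrict_eq_zero.2 h]
  · exact ENNReal.mul_ne_top (ENNReal.inv_ne_top.2 h)
      (ne_top_of_le_ne_top hg (setLIntegral_le_lintegral _ _))

open scoped Classical in
/-- The flow from `z` to `z'` is the mean rate of the events that lead from `z` to `z'`. -/
lemma stationaryLaw_mul_jumpRate [IsFiniteMeasure P] [MeasurableSpace Z]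
    [MeasurableSingletonClass Z] {f : Path → Z} (hf : Measurable f) (z z' : Z) :
    stationaryLaw f P z * jumpRate ψ φ f P z z' =
      ∑' e : Event N, ∫⁻ ω, (if f (path 0 ω) = z ∧ Leads f (path 0 ω) z' e then
        (intensity ψ φ 0 ω e : ℝ≥0∞) else 0) ∂P := by
  rw [jumpRate, ← ENNReal.tsum_mul_left]
  refine tsum_congr fun e => ?_
  rw [stationaryLaw_mul_lintegral_cond, ← lintegral_indicator (measurableSet_zeta_eq hf 0 z)]
  refine lintegral_congr fun ω => ?_
  simp only [Set.indicator_apply, Set.mem_ofPred_eq, zeta, ite_and]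

open scoped Classical in
lemma measurable_ite_leads (hψ : ∀ e u, Measurable fun p : ℝ≥0 × ℝ≥0∞ => ψ e u p.1 p.2)
    (hφ : ∀ e u x, Measurable fun s : ℝ≥0 => φ e u s x) [MeasurableSpace Z]
    [MeasurableSingletonClass Z] {f : Path → Z} (hf : Measurable f) (z z' : Z) (e : Event N) :
    Measurable fun ω : Config N => if f (path 0 ω) = z ∧ Leads f (path 0 ω) z' e then
      (intensity ψ φ 0 ω e : ℝ≥0∞) else 0 :=
  Measurable.ite ((measurableSet_zeta_eq hf 0 z).inter
    ((measurable_path 0) (measurableSet_leads hf z' e)))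
    (measurable_intensity_apply hψ hφ 0 e) measurable_const

open scoped Classical in
lemma tsum_stationaryLaw_mul_jumpRate [IsFiniteMeasure P] [Countable Z] [MeasurableSpace Z]
    [MeasurableSingletonClass Z] (hψ : ∀ e u, Measurable fun p : ℝ≥0 × ℝ≥0∞ => ψ e u p.1 p.2)
    (hφ : ∀ e u x, Measurable fun s : ℝ≥0 => φ e u s x) {f : Path → Z} (hf : Measurable f) (z : Z) :
    (∑' z', if z' = z then 0 else stationaryLaw f P z' * jumpRate ψ φ f P z' z) =
      ∑' e, ∫⁻ ω, (entrySet f z e).indicator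
        (fun _ => (intensity ψ φ 0 ω e : ℝ≥0∞)) (path 0 ω) ∂P := by
  have h1 : ∀ z', (if z' = z then 0 else stationaryLaw f P z' * jumpRate ψ φ f P z' z) =
      ∑' e : Event N, ∫⁻ ω, (if z' = z then 0 else if f (path 0 ω) = z' ∧ Leads f (path 0 ω) z e then
        (intensity ψ φ 0 ω e : ℝ≥0∞) else 0) ∂P := by
    intro z'
    split_ifs
    · simp
    · exact stationaryLaw_mul_jumpRate hf z' z
  rw [tsum_congr h1, ENNReal.tsum_comm]
  refine tsum_congr fun e => ?_
  rw [← lintegral_tsum]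
  · refine lintegral_congr fun ω => ?_
    rw [tsum_eq_single (f (path 0 ω))]
    · by_cases h : f (path 0 ω) = z <;> simp [h, entrySet, Set.indicator_apply]
    · intro z' hz'
      simp [hz'.symm]
  · intro z'
    split_ifs
    · exact aemeasurable_const
    · exact (measurable_ite_leads hψ hφ hf z' z e).aemeasurable

open scoped Classical in
lemma stationaryLaw_mul_exitRate [IsFiniteMeasure P] [Countable Z] [MeasurableSpace Z]
    [MeasurableSingletonClass Z] (hψ : ∀ e u, Measurable fun p : ℝ≥0 × ℝ≥0∞ => ψ e u p.1 p.2)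
    (hφ : ∀ e u x, Measurable fun s : ℝ≥0 => φ e u s x) {f : Path → Z} (hf : Measurable f) (z : Z) :
    stationaryLaw f P z * exitRate ψ φ f P z =
      ∑' e, ∫⁻ ω, (exitSet f z e).indicator
        (fun _ => (intensity ψ φ 0 ω e : ℝ≥0∞)) (path 0 ω) ∂P := by
  have h1 : ∀ z', stationaryLaw f P z * (if z' = z then 0 else jumpRate ψ φ f P z z') =
      ∑' e : Event N, ∫⁻ ω, (if z' = z then 0 else if f (path 0 ω) = z ∧ Leads f (path 0 ω) z' e then
        (intensity ψ φ 0 ω e : ℝ≥0∞) else 0) ∂P := by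
    intro z'
    split_ifs
    · simp
    · exact stationaryLaw_mul_jumpRate hf z z'
  rw [exitRate, ← ENNReal.tsum_mul_left, tsum_congr h1, ENNReal.tsum_comm]
  refine tsum_congr fun e => ?_
  rw [← lintegral_tsum]
  · refine lintegral_congr fun ω => ?_
    rw [tsum_eq_single (f ((path 0 ω).push e.after))]
    · by_cases h : f ((path 0 ω).push e.after) = z <;>
        simp [h, exitSet, Leads, Set.indicator_apply]
    · intro z' hz'
      simp [Leads, hz'.symm]
  · intro z'
    split_ifs
    · exact aemeasurable_const
    · exact (measurable_ite_leads hψ hφ hf z z' e).aemeasurable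

/-- The exit rate of `z` is at most the mean total intensity given `ζ_0 = z`, because each event
leads to at most one value. -/
lemma exitRate_le [Countable Z] [MeasurableSpace Z]
    [MeasurableSingletonClass Z] (hψ : ∀ e u, Measurable fun p : ℝ≥0 × ℝ≥0∞ => ψ e u p.1 p.2)
    (hφ : ∀ e u x, Measurable fun s : ℝ≥0 => φ e u s x) {f : Path → Z} (hf : Measurable f) (z : Z) :
    exitRate ψ φ f P z ≤
      ∫⁻ ω, ∑' e, (intensity ψ φ 0 ω e : ℝ≥0∞) ∂(cond P {ω | zeta f 0 ω = z}) := by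
  classical
  have hint := measurable_intensity_apply (N := N) hψ hφ 0
  rw [lintegral_tsum fun e => (hint e).aemeasurable]
  calc exitRate ψ φ f P z ≤ ∑' z', jumpRate ψ φ f P z z' :=
        ENNReal.tsum_le_tsum fun z' => by split_ifs <;> simp
    _ = ∑' e, ∫⁻ ω, (intensity ψ φ 0 ω e : ℝ≥0∞) * ∑' z',
          (if Leads f (path 0 ω) z' e then 1 else 0) ∂(cond P {ω | zeta f 0 ω = z}) := by
        simp only [jumpRate]
        rw [ENNReal.tsum_comm]
        refine tsum_congr fun e => ?_
        rw [← lintegral_tsum]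
        · simp only [← ENNReal.tsum_mul_left, mul_ite, mul_one, mul_zero]
        · exact fun z' => (Measurable.ite ((measurable_path 0) (measurableSet_leads hf z' e))
            (hint e) measurable_const).aemeasurable
    _ ≤ _ := by
        refine ENNReal.tsum_le_tsum fun e => lintegral_mono fun ω => ?_
        refine mul_le_of_le_one_right' ?_
        rw [tsum_eq_single (f ((path 0 ω).push e.after))]
        · split_ifs <;> simp
        · intro z' hz'
          simp [Leads, hz'.symm]

end OrderBook

end

open OrderBook in
open scoped Classical in
theorem mainTheorem5 {N : ℕ} {Z : Type*} [Countable Z] [MeasurableSpace Z]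
    [MeasurableSingletonClass Z]
    (ψ : Event N → State → ℝ≥0 → ℝ≥0∞ → ℝ≥0)
    (hψ : ∀ e u, Measurable fun p : ℝ≥0 × ℝ≥0∞ => ψ e u p.1 p.2)
    (φ : Event N → State → ℝ≥0 → Event N → ℝ≥0)
    (hφ : ∀ e u x, Measurable fun s : ℝ≥0 => φ e u s x)
    (μ : Measure (History N)) [IsProbabilityMeasure μ]
    (P : Measure (Config N)) (hP : IsMarketLaw ψ φ μ P) (hstat : IsStationary ψ φ P)
    (f : Path → Z) (hf : Measurable f) :
    -- `π` is the law of `ζ_t` at every time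
    (∀ (t : ℝ≥0) (z : Z), P {ω | zeta f t ω = z} = stationaryLaw f P z) ∧
    -- `π 1 = 1`
    (∑' z, stationaryLaw f P z = 1) ∧
    -- `π Q = 0` as a balance of flows in `[0, ∞]`
    (∀ z, (∑' z', if z' = z then 0 else stationaryLaw f P z' * jumpRate ψ φ f P z' z) =
      stationaryLaw f P z * exitRate ψ φ f P z) ∧
    -- `π Q = 0` as an absolutely convergent sum, in each column with a finite diagonal entry
    (∀ z, exitRate ψ φ f P z ≠ ∞ →
      HasSum (fun z' => (stationaryLaw f P z').toReal * generator ψ φ f P z' z) 0) ∧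
    -- all diagonal entries are finite if the events have a finite mean total rate
    (∑' e, ∫⁻ ω, (intensity ψ φ 0 ω e : ℝ≥0∞) ∂P ≠ ∞ → ∀ z, exitRate ψ φ f P z ≠ ∞) ∧
    -- `Q(z, z') = ∑_{e ∈ E(z, z')} E[λ_0(e) | ζ_0 = z]` if the set of events that lead from `z`
    -- directly to `z'` is a fixed set `E(z, z')`
    (∀ (z z' : Z) (E : Set (Event N)), z' ≠ z →
      (∀ᵐ ω ∂P, zeta f 0 ω = z → ∀ e, intensity ψ φ 0 ω e ≠ 0 →
        (Leads f (path 0 ω) z' e ↔ e ∈ E)) →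
      jumpRate ψ φ f P z z' =
        ∑' e : E, ∫⁻ ω, (intensity ψ φ 0 ω e : ℝ≥0∞) ∂(cond P {ω | zeta f 0 ω = z})) := by
  have := hP.isProbabilityMeasure
  have hπ : ∀ z, stationaryLaw f P z ≠ ∞ := fun z => measure_ne_top P _
  have hbal : ∀ z, (∑' z', if z' = z then 0 else stationaryLaw f P z' * jumpRate ψ φ f P z' z) =
      stationaryLaw f P z * exitRate ψ φ f P z := fun z => by
    rw [tsum_stationaryLaw_mul_jumpRate hψ hφ hf, stationaryLaw_mul_exitRate hψ hφ hf]
    exact tsum_lintegral_entrySet_eq hP hψ hφ hstat hf z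
  refine ⟨fun t z => ?_, ?_, hbal, fun z hz => ?_, fun hfin z => ?_, fun z z' E _ hE => ?_⟩
  · have hG : MeasurableSet {q : Path × (Event N → ℝ≥0) | f q.1 = z} :=
      (hf.comp measurable_fst) (measurableSet_singleton z)
    have h := congrArg (fun ν => ν {q : Path × (Event N → ℝ≥0) | f q.1 = z}) (hstat t)
    rwa [Measure.map_apply ((measurable_path t).prodMk (measurable_intensity hψ hφ t)) hG,
      Measure.map_apply ((measurable_path 0).prodMk (measurable_intensity hψ hφ 0)) hG] at h
  · have hζ : Measurable (zeta (N := N) f 0) := hf.comp (measurable_path 0)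
    have h := tsum_measure_preimage_singleton (μ := P) Set.countable_univ
      (f := zeta f 0) fun z _ => hζ (measurableSet_singleton z)
    rw [Set.preimage_univ, measure_univ, tsum_univ fun z => P (zeta f 0 ⁻¹' {z})] at h
    exact h
  · have hsum := hbal z
    have hne : (∑' z', if z' = z then 0 else stationaryLaw f P z' * jumpRate ψ φ f P z' z) ≠ ∞ := by
      rw [hsum]
      exact ENNReal.mul_ne_top (hπ z) hz
    have h1 := ENNReal.hasSum_toReal hne
    rw [← ENNReal.tsum_toReal_eq (ENNReal.ne_top_of_tsum_ne_top hne), hsum, ENNReal.toReal_mul] at h1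
    -- The diagonal term of the series is the opposite of the sum of the other ones.
    have h2 := h1.add (hasSum_ite_eq z
      (-((stationaryLaw f P z).toReal * (exitRate ψ φ f P z).toReal)))
    rw [add_neg_cancel] at h2
    refine h2.congr_fun fun z' => ?_
    by_cases h : z' = z
    · subst h
      simp [generator]
    · simp [generator, h, Ne.symm h]
  · refine ne_top_of_le_ne_top (lintegral_cond_ne_top z ?_) (exitRate_le hψ hφ hf z)
    rwa [lintegral_tsum fun e => (measurable_intensity_apply hψ hφ 0 e).aemeasurable]
  · have hζ := measurableSet_zeta_eq (N := N) hf 0 z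
    have hcond : ∀ᵐ ω ∂(ProbabilityTheory.cond P {ω | zeta f 0 ω = z}),
        ∀ e, intensity ψ φ 0 ω e ≠ 0 → (Leads f (path 0 ω) z' e ↔ e ∈ E) := by
      refine Measure.ae_smul_measure ?_ _
      rw [ae_restrict_iff' hζ]
      exact hE
    rw [jumpRate, tsum_subtype E fun e => ∫⁻ ω, (intensity ψ φ 0 ω e : ℝ≥0∞)
      ∂(ProbabilityTheory.cond P {ω | zeta f 0 ω = z})]
    -- The two integrands differ only where `λ_0(e) = 0`, or off the event `ζ_0 = z`.
    refine tsum_congr fun e => ?_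
    by_cases he : e ∈ E
    · rw [Set.indicator_of_mem he]
      refine lintegral_congr_ae ?_
      filter_upwards [hcond] with ω hω
      by_cases h0 : intensity ψ φ 0 ω e = 0
      · simp [h0]
      · rw [if_pos ((hω e h0).2 he)]
    · rw [Set.indicator_of_notMem he]
      refine (lintegral_congr_ae (g := fun _ => 0) ?_).trans lintegral_zero
      filter_upwards [hcond] with ω hω
      by_cases h0 : intensity ψ φ 0 ω e = 0
      · simp [h0]
      · rw [if_neg fun hl => he ((hω e h0).1 hl)]
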